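/- Let $(M^n,g)$ be a smooth pseudo-Riemannian manifold of signature $(p,q)$ with Levi-Civita connection $\nabla$, and let $\mathcal D\subset TM$ be a null parallel distribution of rank $r$: a smooth rank-$r$ distribution such that $\nabla_X Y\in\Gamma(\mathcal D)$ for all vector fields $X$ and all $Y\in\Gamma(\mathcal D)$, and $g(Y,Z)=0$ for all $Y,Z\in\Gamma(\mathcal D)$. (Thus $(M,g)$ is a Walker manifold of rank $r$.) Let $X_1,\dots,X_r$ be a local basis of parallel sections of $\mathcal D$, that is, a smooth frame of $\mathcal D$ over a nonempty open set $U\subset M$ with $\nabla_Z X_i=0$ on $U$ for every $i$ and every vector field $Z$. Then: 1. The bracket $[X_i,X_j]$ is a smooth section of $\mathcal D$ over $U$ for all $i,j$. 2. There exist unique real constants $c^k_{ij}$ such that $[X_i,X_j]=\sum_k c^k_{ij}X_k$ on $U$ for all $i,j$. 3. The constants are antisymmetric, $c^k_{ij}=-c^k_{ji}$, and satisfy the Jacobi identity $\sum_m\left(c^m_{ij}c^l_{mk}+c^m_{jk}c^l_{mi}+c^m_{ki}c^l_{mj}\right)=0$. Hence the real vector space with basis $X_1,\dots,X_r$ is a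 Lie algebra $\mathfrak g_{\mathcal D}$ under the bilinear bracket with $[X_i,X_j]=\sum_k c^k_{ij}X_k$, and this bracket is the Lie bracket of the vector fields $\sum_i a_iX_i$ $(a_i\in\mathbb R)$ on $U$. 4. The Lie algebra $\mathfrak g_{\mathcal D}$ is independent of the parallel basis up to isomorphism: if $Y_1,\dots,Y_r$ is a local basis of parallel sections of $\mathcal D$ over any nonempty open set $V\subset M$, then the real Lie algebra defined by its structure constants is isomorphic to the one defined by $X_1,\dots,X_r$. -/

import Mathlib

open scoped Manifold ContDiff

noncomputable section

namespace Walker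

/-! ### Metric, Levi-Civita connection, distributions -/

/-- A smooth pseudo-Riemannian metric of signature `(p, q)` on an `n`-manifold: a smooth,
symmetric, non-degenerate `(0,2)`-tensor field that at every point admits a basis of `p` vectors
of square `1` and `q` vectors of square `-1`, pairwise orthogonal (so that `p + q = n`). -/
structure PseudoRiemannianMetric (n p q : ℕ) (M : Type*) [TopologicalSpace M]
    [ChartedSpace (EuclideanSpace ℝ (Fin n)) M] [IsManifold (𝓡 n) ∞ M] where
  val : ∀ x : M, TangentSpace (𝓡 n) x →L[ℝ] TangentSpace (𝓡 n) x →L[ℝ] ℝ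
  symm : ∀ (x : M) (v w : TangentSpace (𝓡 n) x), val x v w = val x w v
  nondegenerate : ∀ (x : M) (v : TangentSpace (𝓡 n) x), (∀ w, val x v w = 0) → v = 0
  signature : ∀ x : M, ∃ b : Module.Basis (Fin p ⊕ Fin q) ℝ (TangentSpace (𝓡 n) x),
    (∀ i j, i ≠ j → val x (b i) (b j) = 0) ∧
    (∀ i : Fin p, val x (b (Sum.inl i)) (b (Sum.inl i)) = 1) ∧
    (∀ j : Fin q, val x (b (Sum.inr j)) (b (Sum.inr j)) = -1)
  contMDiff : ContMDiff (𝓡 n)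
    ((𝓡 n).prod 𝓘(ℝ, EuclideanSpace ℝ (Fin n) →L[ℝ] EuclideanSpace ℝ (Fin n) →L[ℝ] ℝ)) ∞
    (fun x : M ↦ Bundle.TotalSpace.mk'
      (EuclideanSpace ℝ (Fin n) →L[ℝ] EuclideanSpace ℝ (Fin n) →L[ℝ] ℝ)
      (E := fun x : M ↦ TangentSpace (𝓡 n) x →L[ℝ] TangentSpace (𝓡 n) x →L[ℝ] ℝ) x (val x))

variable {n p q r : ℕ} {M : Type*} [TopologicalSpace M]
  [ChartedSpace (EuclideanSpace ℝ (Fin n)) M] [IsManifold (𝓡 n) ∞ M]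

/-- `X` is a smooth vector field on the set `U` (its values off `U` are irrelevant). -/
def SmoothFieldOn (U : Set M) (X : ∀ x : M, TangentSpace (𝓡 n) x) : Prop :=
  ContMDiffOn (𝓡 n) (𝓡 n).tangent ∞ (fun x ↦ (⟨x, X x⟩ : TangentBundle (𝓡 n) M)) U

/-- `X` is differentiable at the point `x`. -/
def FieldDifferentiableAt (X : ∀ x : M, TangentSpace (𝓡 n) x) (x : M) : Prop :=
  MDifferentiableAt (𝓡 n) (𝓡 n).tangent (fun y ↦ (⟨y, X y⟩ : TangentBundle (𝓡 n) M)) x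

/-- `nabla` is the Levi-Civita connection of `g`: the torsion vanishes, and `∇ g = 0`, that is,
`v (g(Y, Z)) = g(∇_v Y, Z) + g(Y, ∇_v Z)`. In Mathlib's notation `nabla Y x v` is `(∇_v Y)(x)`. -/
structure IsLeviCivita (g : PseudoRiemannianMetric n p q M)
    (nabla : CovariantDerivative (𝓡 n) (EuclideanSpace ℝ (Fin n))
      (TangentSpace (𝓡 n) : M → Type _)) : Prop where
  torsion_eq_zero : nabla.torsion = 0
  metric : ∀ (Y Z : ∀ x : M, TangentSpace (𝓡 n) x) (x : M),
    FieldDifferentiableAt Y x → FieldDifferentiableAt Z x → ∀ v : TangentSpace (𝓡 n) x,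
      mvfderiv (𝓡 n) (fun y ↦ g.val y (Y y) (Z y)) x v
        = g.val x (nabla Y x v) (Z x) + g.val x (Y x) (nabla Z x v)

/-- The fields `X 1, …, X r` form a smooth frame over `U` of the family of subspaces `D`. -/
structure IsFrameOn (D : ∀ x : M, Submodule ℝ (TangentSpace (𝓡 n) x)) (U : Set M)
    (X : Fin r → ∀ x : M, TangentSpace (𝓡 n) x) : Prop where
  smooth : ∀ i, SmoothFieldOn U (X i)
  linearIndependent : ∀ x ∈ U, LinearIndependent ℝ (fun i ↦ X i x)
  span_eq : ∀ x ∈ U, Submodule.span ℝ (Set.range (fun i ↦ X i x)) = D x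

/-- A smooth distribution of rank `r`: it has a smooth frame of `r` fields near every point. -/
def IsDistribution (r : ℕ) (D : ∀ x : M, Submodule ℝ (TangentSpace (𝓡 n) x)) : Prop :=
  ∀ x : M, ∃ U : Set M, IsOpen U ∧ x ∈ U ∧
    ∃ X : Fin r → ∀ x : M, TangentSpace (𝓡 n) x, IsFrameOn D U X

/-- `Y` is a smooth section of `D` over `U`. -/
def IsSectionOn (D : ∀ x : M, Submodule ℝ (TangentSpace (𝓡 n) x)) (U : Set M)
    (Y : ∀ x : M, TangentSpace (𝓡 n) x) : Prop :=
  SmoothFieldOn U Y ∧ ∀ x ∈ U, Y x ∈ D x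

/-- `D` is a null parallel distribution of rank `r` on `(M, g)`, where `nabla` is the Levi-Civita
connection of `g`; thus `(M, g)` is a Walker manifold of rank `r`. -/
structure IsNullParallelDistribution (g : PseudoRiemannianMetric n p q M)
    (nabla : CovariantDerivative (𝓡 n) (EuclideanSpace ℝ (Fin n))
      (TangentSpace (𝓡 n) : M → Type _)) (r : ℕ)
    (D : ∀ x : M, Submodule ℝ (TangentSpace (𝓡 n) x)) : Prop where
  isDistribution : IsDistribution r D
  parallel : ∀ (U : Set M) (X Y : ∀ x : M, TangentSpace (𝓡 n) x), IsOpen U →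
    SmoothFieldOn U X → IsSectionOn D U Y → IsSectionOn D U (fun x ↦ nabla Y x (X x))
  isotropic : ∀ (x : M), ∀ v ∈ D x, ∀ w ∈ D x, g.val x v w = 0

/-- `X 1, …, X r` is a local basis of parallel sections of `D`, over the nonempty open set `U`:
a frame of `D` over `U` with `∇_v X_i = 0` for all tangent vectors `v` at points of `U`. -/
structure IsParallelBasisOn
    (nabla : CovariantDerivative (𝓡 n) (EuclideanSpace ℝ (Fin n))
      (TangentSpace (𝓡 n) : M → Type _))
    (D : ∀ x : M, Submodule ℝ (TangentSpace (𝓡 n) x)) (U : Set M)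
    (X : Fin r → ∀ x : M, TangentSpace (𝓡 n) x) : Prop where
  isOpen : IsOpen U
  nonempty : U.Nonempty
  isFrame : IsFrameOn D U X
  parallel : ∀ i, ∀ x ∈ U, ∀ v : TangentSpace (𝓡 n) x, nabla (X i) x v = 0

/-- `[X_i, X_j] = ∑ₖ c i j k X_k` on `U`, with real constants `c i j k`. -/
def HasStructureConstants (U : Set M) (X : Fin r → ∀ x : M, TangentSpace (𝓡 n) x)
    (c : Fin r → Fin r → Fin r → ℝ) : Prop :=
  ∀ i j, ∀ x ∈ U,
    VectorField.mlieBracket (𝓡 n) (X i) (X j) x = ∑ k, c i j k • X k x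

/-! ### The Lie algebra with given structure constants -/

/-- The constants `c i j k` are the structure constants of a Lie algebra: antisymmetry and the
Jacobi identity. -/
structure IsLieConstants (c : Fin r → Fin r → Fin r → ℝ) : Prop where
  antisymm : ∀ i j k, c i j k = -c j i k
  jacobi : ∀ i j k l,
    ∑ m, (c i j m * c m k l + c j k m * c m i l + c k i m * c m j l) = 0

/-- The structure algebra: the real vector space with basis `e_1, …, e_r` (to be thought of as
`X_1, …, X_r`) and the bilinear bracket with `[e_i, e_j] = ∑ₖ c i j k e_k`. -/
def StructureAlgebra {c : Fin r → Fin r → Fin r → ℝ} (_hc : IsLieConstants c) : Type :=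
  Fin r → ℝ

namespace StructureAlgebra

variable {c : Fin r → Fin r → Fin r → ℝ} (hc : IsLieConstants c)

instance : AddCommGroup (StructureAlgebra hc) := inferInstanceAs (AddCommGroup (Fin r → ℝ))

instance : Module ℝ (StructureAlgebra hc) := inferInstanceAs (Module ℝ (Fin r → ℝ))

instance : Bracket (StructureAlgebra hc) (StructureAlgebra hc) :=
  ⟨fun a b k ↦ ∑ i, ∑ j, a i * b j * c i j k⟩

variable {hc}

theorem bracket_apply (a b : StructureAlgebra hc) (k : Fin r) :
    ⁅a, b⁆ k = ∑ i, ∑ j, a i * b j * c i j k := rfl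

theorem add_apply (a b : StructureAlgebra hc) (k : Fin r) : (a + b) k = a k + b k := rfl

theorem smul_apply (t : ℝ) (a : StructureAlgebra hc) (k : Fin r) : (t • a) k = t * a k := rfl

theorem zero_apply (k : Fin r) : (0 : StructureAlgebra hc) k = 0 := rfl

theorem bracket_skew (a b : StructureAlgebra hc) (k : Fin r) : ⁅a, b⁆ k = -⁅b, a⁆ k := by
  rw [bracket_apply, bracket_apply, Finset.sum_comm, ← Finset.sum_neg_distrib]
  refine Finset.sum_congr rfl fun i _ ↦ ?_
  rw [← Finset.sum_neg_distrib]
  refine Finset.sum_congr rfl fun j _ ↦ ?_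
  rw [hc.antisymm j i k]; ring

theorem bracket_bracket (a b d : StructureAlgebra hc) (l : Fin r) :
    ⁅⁅a, b⁆, d⁆ l = ∑ i, ∑ j, ∑ k, a i * b j * d k * ∑ m, c i j m * c m k l := by
  simp only [bracket_apply, Finset.sum_mul, Finset.mul_sum]
  calc _ = ∑ m, ∑ i, ∑ k, ∑ j, a i * b j * c i j m * d k * c m k l := by
        refine Finset.sum_congr rfl fun m _ ↦ ?_
        exact Finset.sum_comm
    _ = ∑ i, ∑ m, ∑ k, ∑ j, a i * b j * c i j m * d k * c m k l := Finset.sum_comm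
    _ = _ := by
        refine Finset.sum_congr rfl fun i _ ↦ ?_
        calc _ = ∑ m, ∑ j, ∑ k, a i * b j * c i j m * d k * c m k l :=
              Finset.sum_congr rfl fun m _ ↦ Finset.sum_comm
          _ = ∑ j, ∑ m, ∑ k, a i * b j * c i j m * d k * c m k l := Finset.sum_comm
          _ = ∑ j, ∑ k, ∑ m, a i * b j * c i j m * d k * c m k l :=
              Finset.sum_congr rfl fun j _ ↦ Finset.sum_comm
          _ = _ := by
              refine Finset.sum_congr rfl fun j _ ↦ Finset.sum_congr rfl fun k _ ↦
                Finset.sum_congr rfl fun m _ ↦ ?_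
              ring

theorem bracket_jacobi (a b d : StructureAlgebra hc) (l : Fin r) :
    ⁅⁅a, b⁆, d⁆ l + ⁅⁅b, d⁆, a⁆ l + ⁅⁅d, a⁆, b⁆ l = 0 := by
  have h2 : ⁅⁅b, d⁆, a⁆ l = ∑ i, ∑ j, ∑ k, a i * b j * d k * ∑ m, c j k m * c m i l := by
    rw [bracket_bracket]
    calc _ = ∑ j, ∑ i, ∑ k, b j * d k * a i * ∑ m, c j k m * c m i l :=
          Finset.sum_congr rfl fun j _ ↦ Finset.sum_comm
      _ = ∑ i, ∑ j, ∑ k, b j * d k * a i * ∑ m, c j k m * c m i l := Finset.sum_comm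
      _ = _ := by
          refine Finset.sum_congr rfl fun i _ ↦ Finset.sum_congr rfl fun j _ ↦
            Finset.sum_congr rfl fun k _ ↦ ?_
          ring
  have h3 : ⁅⁅d, a⁆, b⁆ l = ∑ i, ∑ j, ∑ k, a i * b j * d k * ∑ m, c k i m * c m j l := by
    rw [bracket_bracket]
    calc _ = ∑ i, ∑ k, ∑ j, d k * a i * b j * ∑ m, c k i m * c m j l := Finset.sum_comm
      _ = ∑ i, ∑ j, ∑ k, d k * a i * b j * ∑ m, c k i m * c m j l :=
          Finset.sum_congr rfl fun i _ ↦ Finset.sum_comm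
      _ = _ := by
          refine Finset.sum_congr rfl fun i _ ↦ Finset.sum_congr rfl fun j _ ↦
            Finset.sum_congr rfl fun k _ ↦ ?_
          ring
  rw [bracket_bracket, h2, h3]
  simp only [← Finset.sum_add_distrib]
  refine Finset.sum_eq_zero fun i _ ↦ Finset.sum_eq_zero fun j _ ↦
    Finset.sum_eq_zero fun k _ ↦ ?_
  rw [← mul_add, ← mul_add, ← Finset.sum_add_distrib, ← Finset.sum_add_distrib,
    hc.jacobi i j k l, mul_zero]

variable (hc)

instance : LieRing (StructureAlgebra hc) where
  add_lie a b d := by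
    funext k
    simp only [add_apply, bracket_apply, add_mul, Finset.sum_add_distrib]
  lie_add a b d := by
    funext k
    simp only [add_apply, bracket_apply, add_mul, mul_add, Finset.sum_add_distrib]
  lie_self a := by
    funext k
    have := bracket_skew a a k
    rw [zero_apply]; linarith
  leibniz_lie a b d := by
    funext l
    have h1 := bracket_jacobi a b d l
    have h2 := bracket_skew a ⁅b, d⁆ l
    have h3 := bracket_skew b ⁅a, d⁆ l
    have h4 : ⁅⁅d, a⁆, b⁆ l = -⁅⁅a, d⁆, b⁆ l := by
      have : ⁅d, a⁆ = -⁅a, d⁆ := funext fun k ↦ bracket_skew d a k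
      rw [this, bracket_apply, bracket_apply, ← Finset.sum_neg_distrib]
      refine Finset.sum_congr rfl fun i _ ↦ ?_
      rw [← Finset.sum_neg_distrib]
      refine Finset.sum_congr rfl fun j _ ↦ ?_
      change -(⁅a, d⁆ i) * _ * _ = _
      ring
    rw [add_apply]
    linarith

instance : LieAlgebra ℝ (StructureAlgebra hc) where
  lie_smul t a b := by
    funext k
    rw [smul_apply, bracket_apply, bracket_apply, Finset.mul_sum]
    refine Finset.sum_congr rfl fun i _ ↦ ?_
    rw [Finset.mul_sum]
    refine Finset.sum_congr rfl fun j _ ↦ ?_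
    rw [smul_apply]; ring

end StructureAlgebra

end Walker

end

namespace Walker

section ParallelFields

variable {n p q r : ℕ} {M : Type*} [TopologicalSpace M]
  [ChartedSpace (EuclideanSpace ℝ (Fin n)) M] [IsManifold (𝓡 n) ∞ M]
  {nabla : CovariantDerivative (𝓡 n) (EuclideanSpace ℝ (Fin n))
    (TangentSpace (𝓡 n) : M → Type _)}

/-! The Lie algebra is always abelian. Vanishing torsion gives `[X, Y] = ∇_X Y - ∇_Y X`, so two
parallel fields commute (`mlieBracket_eq_zero_of_parallel`). Hence all brackets of a parallel basis
vanish and `c = 0` is a family of structure constants. By linear independence at a single point it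
is the only one (`HasStructureConstants.unique`). Antisymmetry and Jacobi are then trivial. Since
constant-coefficient combinations of parallel fields are again parallel (`parallel_sum_smul`), they
commute too, in agreement with the zero bracket. Any other parallel basis also has zero constants,
so the two Lie algebras coincide, even when `U` and `V` are disjoint. -/

theorem SmoothFieldOn.fieldDifferentiableAt {U : Set M} {X : ∀ x : M, TangentSpace (𝓡 n) x}
    (hX : SmoothFieldOn U X) (hU : IsOpen U) {x : M} (hx : x ∈ U) :
    FieldDifferentiableAt X x :=
  (hX.contMDiffAt (hU.mem_nhds hx)).mdifferentiableAt (by simp)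

/-- For a torsion-free connection `[X, Y] = ∇_X Y - ∇_Y X`, so fields that are parallel at `x`
commute at `x`. -/
theorem mlieBracket_eq_zero_of_parallel (htor : nabla.torsion = 0)
    {X Y : ∀ x : M, TangentSpace (𝓡 n) x} {x : M}
    (hX : FieldDifferentiableAt X x) (hY : FieldDifferentiableAt Y x)
    (hX0 : ∀ v, nabla X x v = 0) (hY0 : ∀ v, nabla Y x v = 0) :
    VectorField.mlieBracket (𝓡 n) X Y x = 0 := by
  rw [← nabla.torsion_eq_zero_iff.1 htor hX hY, hX0, hY0, sub_zero]

/-- Real linear combinations of parallel fields are differentiable and parallel. -/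
theorem parallel_sum_smul {ι : Type*} (s : Finset ι) (a : ι → ℝ)
    {X : ι → ∀ x : M, TangentSpace (𝓡 n) x} {x : M}
    (hX : ∀ i, FieldDifferentiableAt (X i) x) (hX0 : ∀ i, ∀ v, nabla (X i) x v = 0) :
    FieldDifferentiableAt (fun y ↦ ∑ i ∈ s, a i • X i y) x ∧
      ∀ v, nabla (fun y ↦ ∑ i ∈ s, a i • X i y) x v = 0 := by
  classical
  induction s using Finset.induction_on with
  | empty =>
    simp only [Finset.sum_empty]
    refine ⟨(Bundle.contMDiff_zeroSection ℝ (TangentSpace (𝓡 n) : M → Type _) (n := ∞)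
      |>.mdifferentiable (by simp)) x, fun v ↦ ?_⟩
    exact congrArg (fun σ ↦ σ x v) nabla.zero
  | insert i s hi ih =>
    simp only [Finset.sum_insert hi]
    have hsmul : FieldDifferentiableAt (fun y ↦ a i • X i y) x :=
      (mdifferentiableAt_const (c := a i)).smul_section (hX i)
    refine ⟨mdifferentiableAt_add_section hsmul ih.1, fun v ↦ ?_⟩
    have hadd := nabla.isCovariantDerivativeOnUniv.add hsmul ih.1
    have h3 : nabla (fun y ↦ a i • X i y) x v = 0 := by
      refine (congrArg (fun L ↦ L v)
        (nabla.isCovariantDerivativeOnUniv.smul_const (a i) (hX i) trivial)).trans ?_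
      simp [hX0 i v]
    refine (congrArg (fun L ↦ L v) hadd).trans ?_
    simp [h3, ih.2 v]

/-- Both combinations are themselves parallel, so torsion-freeness applies to them directly and the
bracket need not be expanded bilinearly. -/
theorem IsParallelBasisOn.mlieBracket_sum_smul (htor : nabla.torsion = 0)
    {D : ∀ x : M, Submodule ℝ (TangentSpace (𝓡 n) x)} {U : Set M}
    {X : Fin r → ∀ x : M, TangentSpace (𝓡 n) x} (hX : IsParallelBasisOn nabla D U X)
    (a b : Fin r → ℝ) {x : M} (hx : x ∈ U) :
    VectorField.mlieBracket (𝓡 n) (fun y ↦ ∑ i, a i • X i y) (fun y ↦ ∑ j, b j • X j y) x = 0 := by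
  have hd i := (hX.isFrame.smooth i).fieldDifferentiableAt hX.isOpen hx
  have ha := parallel_sum_smul Finset.univ a hd fun i ↦ hX.parallel i x hx
  have hb := parallel_sum_smul Finset.univ b hd fun i ↦ hX.parallel i x hx
  exact mlieBracket_eq_zero_of_parallel htor ha.1 hb.1 ha.2 hb.2

theorem IsParallelBasisOn.mlieBracket (htor : nabla.torsion = 0)
    {D : ∀ x : M, Submodule ℝ (TangentSpace (𝓡 n) x)} {U : Set M}
    {X : Fin r → ∀ x : M, TangentSpace (𝓡 n) x} (hX : IsParallelBasisOn nabla D U X)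
    (i j : Fin r) {x : M} (hx : x ∈ U) :
    VectorField.mlieBracket (𝓡 n) (X i) (X j) x = 0 :=
  mlieBracket_eq_zero_of_parallel htor
    ((hX.isFrame.smooth i).fieldDifferentiableAt hX.isOpen hx)
    ((hX.isFrame.smooth j).fieldDifferentiableAt hX.isOpen hx)
    (hX.parallel i x hx) (hX.parallel j x hx)

/-- A field that vanishes on `U` is a smooth section of every family of subspaces over `U`. -/
theorem isSectionOn_of_eq_zero (D : ∀ x : M, Submodule ℝ (TangentSpace (𝓡 n) x)) {U : Set M}
    {Y : ∀ x : M, TangentSpace (𝓡 n) x} (hY : ∀ x ∈ U, Y x = 0) : IsSectionOn D U Y := by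
  refine ⟨?_, fun x hx ↦ by rw [hY x hx]; exact (D x).zero_mem⟩
  -- Smoothness on `U` depends only on the values there, which are those of the zero section.
  refine (Bundle.contMDiff_zeroSection ℝ (TangentSpace (𝓡 n) : M → Type _)
    (n := ∞)).contMDiffOn.congr fun x hx ↦ ?_
  rw [hY x hx]
  rfl

/-- Structure constants with respect to a frame over a nonempty set are unique. -/
theorem HasStructureConstants.unique {D : ∀ x : M, Submodule ℝ (TangentSpace (𝓡 n) x)}
    {U : Set M} {X : Fin r → ∀ x : M, TangentSpace (𝓡 n) x} (hX : IsFrameOn D U X)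
    (hU : U.Nonempty) {c c' : Fin r → Fin r → Fin r → ℝ}
    (h : HasStructureConstants U X c) (h' : HasStructureConstants U X c') : c = c' := by
  -- The coefficients are constants, so comparing them at one point of `U` suffices.
  obtain ⟨x, hx⟩ := hU
  funext i j k
  exact congrFun ((hX.linearIndependent x hx).fintypeLinearCombination_injective
    (by simpa [Fintype.linearCombination_apply] using (h i j x hx).symm.trans (h' i j x hx))) k

/-- A parallel basis is a frame of commuting fields: its structure constants vanish. -/
theorem IsParallelBasisOn.hasStructureConstants_zero (htor : nabla.torsion = 0)
    {D : ∀ x : M, Submodule ℝ (TangentSpace (𝓡 n) x)} {U : Set M}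
    {X : Fin r → ∀ x : M, TangentSpace (𝓡 n) x} (hX : IsParallelBasisOn nabla D U X) :
    HasStructureConstants U X 0 := fun i j x hx ↦ by
  simp [hX.mlieBracket htor i j hx]

end ParallelFields

theorem isLieConstants_zero (r : ℕ) : IsLieConstants (0 : Fin r → Fin r → Fin r → ℝ) where
  antisymm := by simp
  jacobi := by simp

end Walker

theorem lemma3p3 {n p q r : ℕ} {M : Type*} [TopologicalSpace M] [T2Space M]
    [SecondCountableTopology M] [ChartedSpace (EuclideanSpace ℝ (Fin n)) M]
    [IsManifold (𝓡 n) ∞ M]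
    (g : Walker.PseudoRiemannianMetric n p q M)
    (nabla : CovariantDerivative (𝓡 n) (EuclideanSpace ℝ (Fin n))
      (TangentSpace (𝓡 n) : M → Type _))
    (hnabla : Walker.IsLeviCivita g nabla)
    (D : ∀ x : M, Submodule ℝ (TangentSpace (𝓡 n) x))
    (hD : Walker.IsNullParallelDistribution g nabla r D)
    (U : Set M) (X : Fin r → ∀ x : M, TangentSpace (𝓡 n) x)
    (hX : Walker.IsParallelBasisOn nabla D U X) :
    -- the brackets are sections of `D`
    (∀ i j, Walker.IsSectionOn D U (VectorField.mlieBracket (𝓡 n) (X i) (X j))) ∧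
    -- with constant (and uniquely determined) coefficients
    ∃ c : Fin r → Fin r → Fin r → ℝ, Walker.HasStructureConstants U X c ∧
      (∀ c', Walker.HasStructureConstants U X c' → c' = c) ∧
      -- which satisfy antisymmetry and the Jacobi identity, hence define a Lie algebra
      ∃ hc : Walker.IsLieConstants c,
        -- whose bracket is the bracket of the real linear combinations of the `X i`
        (∀ a b : Walker.StructureAlgebra hc, ∀ x ∈ U,
          VectorField.mlieBracket (𝓡 n) (fun y ↦ ∑ i, a i • X i y) (fun y ↦ ∑ j, b j • X j y) x
            = ∑ k, ⁅a, b⁆ k • X k x) ∧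
        -- and which does not depend on the local parallel basis, up to isomorphism
        ∀ (V : Set M) (Y : Fin r → ∀ x : M, TangentSpace (𝓡 n) x),
          Walker.IsParallelBasisOn nabla D V Y →
          ∀ (c' : Fin r → Fin r → Fin r → ℝ) (hc' : Walker.IsLieConstants c'),
            Walker.HasStructureConstants V Y c' →
            Nonempty (Walker.StructureAlgebra hc ≃ₗ⁅ℝ⁆ Walker.StructureAlgebra hc') := by
  have htor := hnabla.torsion_eq_zero
  have h0 := hX.hasStructureConstants_zero htor
  refine ⟨fun i j ↦ Walker.isSectionOn_of_eq_zero D fun x hx ↦ hX.mlieBracket htor i j hx,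
    0, h0, fun c' h' ↦ h'.unique hX.isFrame hX.nonempty h0, Walker.isLieConstants_zero r,
    fun a b x hx ↦ ?_, fun V Y hY c' hc' h' ↦ ?_⟩
  · rw [hX.mlieBracket_sum_smul htor a b hx]
    simp [Walker.StructureAlgebra.bracket_apply]
  -- Uniqueness over `V` forces `c' = 0`. The two structure algebras then differ only in the proof
  -- of `IsLieConstants 0`, so the identity is an isomorphism.
  · obtain rfl := h'.unique hY.isFrame hY.nonempty (hY.hasStructureConstants_zero htor)
    exact ⟨LieEquiv.refl⟩
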